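/- Let $E\subseteq\mathbb N_0$ be a (finite or infinite) segment of consecutive integers with $\min E=0$, and let $\{N(t),t\ge0\}$ be a birth-death process with state space $E$ on a filtered probability space, i.e. a time-homogeneous Markov process with transition function $p(t,x;y)=\mathbb P(N(t+s)=x\mid N(s)=y)$ (with $\sum_{x\in E}p(t,x;y)=1$), whose infinitesimal rates are birth rates $b(x)\ge0$ and death rates $d(x)\ge0$, where $d(0)=0$ and $b(\max E)=0$ if $E$ is finite. Write $\nabla^+f(x)=f(x+1)-f(x)$, $\Delta f(x)=f(x+1)-2f(x)+f(x-1)$, and let $\mathcal G f=(b-d)\nabla^+f+d\,\Delta f$ be its generator. Suppose that $N$ is *solvable*, i.e. - $N$ is irreducible and recurrent; - $N$ has an invariant probability distribution $\mathfrak m$ on $E$; write $m(x)=\mathfrak m(\{x\})$; - the spectrum of $\mathcal G$ in $\ell^2(\mathfrak m)$ is purely discrete (it consists of isolated eigenvalues of finite multiplicity) and equals $\{\lambda_n:n\in E\}$ with $\lambda_0=0$ and $\lambda_n<0$ for $n\in E$, $n\ge1$; - for every $n\in E$ there is a polynomial $P_n$ of degree $n$, in $\ell^2(\mathfrak m)$,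 with $\mathcal GP_n=\lambda_nP_n$ on $E$, and $\sum_{x\in E}P_n(x)P_k(x)m(x)=0$ for $n\ne k$; - $m$ solves the discrete Pearson equation $\nabla^+(d\,m)(x)=(b(x)-d(x))m(x)$ for $x\in E$; - on $E$, $d$ is given by a polynomial of degree at most $2$ and $b-d$ by a polynomial of degree at most $1$. Suppose that $N(0)$ has distribution $\mathfrak m$. Then $\mathbb E[N(t)^2]<\infty$ for all $t\ge0$, and there is a constant $a_1\in\mathbb R$ such that for all $t,s\ge0$ $$\operatorname{Cov}(N(t),N(s))=a_1^2\,e^{\lambda_1|t-s|}.$$ (If $E=\{0\}$, then $\lambda_1$ may be any real number.) -/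

import Mathlib

open MeasureTheory ProbabilityTheory Filter Topology Polynomial
open scoped NNReal ENNReal

noncomputable section

namespace BirthDeath

/-- Forward difference `f (x + 1) - f x`. -/
def nablaPlus {V : Type*} [AddCommGroup V] (f : ℕ → V) (x : ℕ) : V :=
  f (x + 1) - f x

/-- Second order central difference `f (x + 1) - 2 f x + f (x - 1)`. At `x = 0` the truncated
subtraction is harmless: the generator multiplies this term by the death rate `d 0 = 0`. -/
def centralDiff {V : Type*} [AddCommGroup V] (f : ℕ → V) (x : ℕ) : V :=
  f (x + 1) - (2 : ℕ) • f x + f (x - 1)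

/-- The generator `𝒢 f = (b - d) ∇⁺ f + d Δ f` with birth rates `b` and death rates `d`. -/
def generator {V : Type*} [AddCommGroup V] [Module ℝ V] (b d : ℕ → ℝ) (f : ℕ → V) (x : ℕ) : V :=
  (b x - d x) • nablaPlus f x + d x • centralDiff f x

/-- `b` and `d` are birth and death rates on the state space `E ⊆ ℕ`, a segment with minimum `0`:
they are nonnegative on `E` and the chain cannot leave `E`. Values off `E` play no role. -/
structure IsRates (E : Set ℕ) (b d : ℕ → ℝ) : Prop where
  zero_mem : 0 ∈ E
  segment : E.OrdConnected
  birth_nonneg : ∀ x ∈ E, 0 ≤ b x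
  death_nonneg : ∀ x ∈ E, 0 ≤ d x
  death_zero : d 0 = 0
  birth_last : ∀ x ∈ E, x + 1 ∉ E → b x = 0

/-- The infinitesimal rate from `x` to `y`. -/
def rate (b d : ℕ → ℝ) (x y : ℕ) : ℝ :=
  if y = x + 1 then b x else if y + 1 = x then d x else if y = x then -(b x + d x) else 0

/-- `p t x y` is the probability of a move from `x` to `y` in time `t`: a stochastic transition
function on `E` with infinitesimal rates `rate b d`. Values off `E` play no role. -/
structure IsBirthDeathTransition (E : Set ℕ) (b d : ℕ → ℝ) (p : ℝ≥0 → ℕ → ℕ → ℝ) : Prop where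
  rates : IsRates E b d
  nonneg : ∀ t, ∀ x ∈ E, ∀ y ∈ E, 0 ≤ p t x y
  sum_one : ∀ t, ∀ x ∈ E, HasSum (fun y : E => p t x y) 1
  zero_time : ∀ x ∈ E, ∀ y ∈ E, p 0 x y = if y = x then 1 else 0
  chapman_kolmogorov : ∀ s t, ∀ x ∈ E, ∀ y ∈ E,
    HasSum (fun z : E => p s x z * p t z y) (p (s + t) x y)
  infinitesimal : ∀ x ∈ E, ∀ y ∈ E,
    Tendsto (fun t : ℝ≥0 => (p t x y - p 0 x y) / (t : ℝ)) (𝓝[>] 0) (𝓝 (rate b d x y))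

/-- `N` is a birth-death process on the filtered probability space `(Ω, ℱ, Pr)` with state
space `E`, rates `b`, `d` and transition function `p`: a time-homogeneous Markov process. -/
structure IsBirthDeathProcess {Ω : Type*} {mΩ : MeasurableSpace Ω} (ℱ : Filtration ℝ≥0 mΩ)
    (Pr : Measure Ω) (E : Set ℕ) (b d : ℕ → ℝ) (p : ℝ≥0 → ℕ → ℕ → ℝ)
    (N : ℝ≥0 → Ω → ℕ) : Prop where
  transition : IsBirthDeathTransition E b d p
  adapted : ∀ t, Measurable[ℱ t] (N t)
  mem_state : ∀ t ω, N t ω ∈ E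
  markov : ∀ s t, ∀ y ∈ E,
    Pr[(N (s + t) ⁻¹' {y}).indicator (fun _ => (1 : ℝ)) | ℱ s] =ᵐ[Pr] fun ω => p t (N s ω) y

/-- Every state leads to every other state. -/
def IsIrreducible (E : Set ℕ) (p : ℝ≥0 → ℕ → ℕ → ℝ) : Prop :=
  ∀ x ∈ E, ∀ y ∈ E, ∃ t, 0 < p t x y

/-- Every state is recurrent: the expected total time spent at `x`, starting from `x`, is
infinite. -/
def IsRecurrent (E : Set ℕ) (p : ℝ≥0 → ℕ → ℕ → ℝ) : Prop :=
  ∀ x ∈ E, ∫⁻ t in Set.Ici (0 : ℝ), ENNReal.ofReal (p t.toNNReal x x) = ⊤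

/-- `𝔪` is an invariant probability distribution of the transition function `p` on `E`. -/
structure IsInvariant (E : Set ℕ) (p : ℝ≥0 → ℕ → ℕ → ℝ) (𝔪 : Measure ℕ) : Prop where
  isProbability : IsProbabilityMeasure 𝔪
  carrier : 𝔪 Eᶜ = 0
  invariant : ∀ t, ∀ y ∈ E, HasSum (fun x : E => 𝔪.real {(x : ℕ)} * p t x y) (𝔪.real {y})

/-- The complex space `ℓ²(𝔪)` on `E`; functions on `E` are extended by zero to `ℕ`. -/
def ellTwo (E : Set ℕ) (𝔪 : Measure ℕ) : Submodule ℂ (ℕ → ℂ) where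
  carrier := {f | (∀ x ∉ E, f x = 0) ∧ MemLp f 2 𝔪}
  zero_mem' := ⟨fun _ _ => rfl, MemLp.zero⟩
  add_mem' := fun {f g} hf hg =>
    ⟨fun x hx => by simp [hf.1 x hx, hg.1 x hx], hf.2.add hg.2⟩
  smul_mem' := fun c f hf => ⟨fun x hx => by simp [hf.1 x hx], hf.2.const_smul c⟩

/-- `z` lies in the resolvent set of `𝒢`, acting in `ℓ²(𝔪)` with its maximal domain
`{f ∈ ℓ²(𝔪) | 𝒢 f ∈ ℓ²(𝔪)}`: the operator `𝒢 - z` is a bijection from the domain onto `ℓ²(𝔪)`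
with bounded inverse. -/
def InResolventSet (E : Set ℕ) (b d : ℕ → ℝ) (𝔪 : Measure ℕ) (z : ℂ) : Prop :=
  (∀ g ∈ ellTwo E 𝔪, ∃! f, f ∈ ellTwo E 𝔪 ∧ ∀ x ∈ E, generator b d f x - z * f x = g x) ∧
  ∃ C : ℝ≥0, ∀ f ∈ ellTwo E 𝔪, ∀ g ∈ ellTwo E 𝔪,
    (∀ x ∈ E, generator b d f x - z * f x = g x) → eLpNorm f 2 𝔪 ≤ C * eLpNorm g 2 𝔪

/-- The spectrum of `𝒢` in `ℓ²(𝔪)`. -/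
def generatorSpectrum (E : Set ℕ) (b d : ℕ → ℝ) (𝔪 : Measure ℕ) : Set ℂ :=
  {z | ¬ InResolventSet E b d 𝔪 z}

/-- The eigenspace of `𝒢` in `ℓ²(𝔪)` for `z`. -/
def generatorEigenspace (E : Set ℕ) (b d : ℕ → ℝ) (𝔪 : Measure ℕ) (z : ℂ) :
    Submodule ℂ (ℕ → ℂ) where
  carrier := {f | f ∈ ellTwo E 𝔪 ∧ ∀ x ∈ E, generator b d f x = z * f x}
  zero_mem' := ⟨Submodule.zero_mem _, fun x _ => by simp [generator, nablaPlus, centralDiff]⟩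
  add_mem' := fun {f g} hf hg => ⟨Submodule.add_mem _ hf.1 hg.1, fun x hx => by
    have h1 := hf.2 x hx
    have h2 := hg.2 x hx
    simp only [generator, nablaPlus, centralDiff, Complex.real_smul, nsmul_eq_mul,
      Pi.add_apply] at h1 h2 ⊢
    linear_combination h1 + h2⟩
  smul_mem' := fun c f hf => ⟨Submodule.smul_mem _ c hf.1, fun x hx => by
    have h1 := hf.2 x hx
    simp only [generator, nablaPlus, centralDiff, Complex.real_smul, nsmul_eq_mul,
      Pi.smul_apply, smul_eq_mul] at h1 ⊢
    linear_combination c * h1⟩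

/-- The spectrum of `𝒢` is purely discrete: it consists of isolated points, each of them an
eigenvalue of finite multiplicity. -/
def HasPurelyDiscreteSpectrum (E : Set ℕ) (b d : ℕ → ℝ) (𝔪 : Measure ℕ) : Prop :=
  ∀ z ∈ generatorSpectrum E b d 𝔪,
    (∃ ε > 0, ∀ w ∈ generatorSpectrum E b d 𝔪, ‖w - z‖ < ε → w = z) ∧
    generatorEigenspace E b d 𝔪 z ≠ ⊥ ∧
    FiniteDimensional ℂ (generatorEigenspace E b d 𝔪 z)

/-- The birth-death transition function `p` with rates `b`, `d` on `E` is solvable, with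
invariant distribution `𝔪`, eigenvalues `lam n` and orthogonal polynomials `P n` for `n ∈ E`.
Values `lam n`, `P n` with `n ∉ E` play no role. -/
structure IsSolvable (E : Set ℕ) (b d : ℕ → ℝ) (p : ℝ≥0 → ℕ → ℕ → ℝ) (𝔪 : Measure ℕ)
    (lam : ℕ → ℝ) (P : ℕ → ℝ[X]) : Prop where
  irreducible : IsIrreducible E p
  recurrent : IsRecurrent E p
  invariant : IsInvariant E p 𝔪
  purely_discrete : HasPurelyDiscreteSpectrum E b d 𝔪
  spectrum_eq : generatorSpectrum E b d 𝔪 = (fun n => (lam n : ℂ)) '' E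
  lam_zero : lam 0 = 0
  lam_neg : ∀ n ∈ E, 1 ≤ n → lam n < 0
  degree_eq : ∀ n ∈ E, (P n).degree = n
  square_integrable : ∀ n ∈ E, MemLp (fun x : ℕ => (P n).eval (x : ℝ)) 2 𝔪
  eigenfunction : ∀ n ∈ E, ∀ x ∈ E,
    generator b d (fun y : ℕ => (P n).eval (y : ℝ)) x = lam n * (P n).eval (x : ℝ)
  orthogonal : ∀ n ∈ E, ∀ k ∈ E, n ≠ k →
    ∫ x : ℕ, (P n).eval (x : ℝ) * (P k).eval (x : ℝ) ∂𝔪 = 0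
  pearson : ∀ x ∈ E,
    nablaPlus (fun y => d y * 𝔪.real {y}) x = (b x - d x) * 𝔪.real {x}
  death_poly : ∃ D : ℝ[X], D.natDegree ≤ 2 ∧ ∀ x ∈ E, d x = D.eval (x : ℝ)
  drift_poly : ∃ T : ℝ[X], T.natDegree ≤ 1 ∧ ∀ x ∈ E, b x - d x = T.eval (x : ℝ)

end BirthDeath

end

/-!
Write `m x = 𝔪 {x}` and let `v x = x + c` be the monic multiple of `P 1`, so `𝒢 v = λ₁ v` on `E`.
The covariance formula amounts to `E[v(N s) v(N (s + t))] = exp (λ₁ t) E[v(N 0)²]`; orthogonality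
of `P 1` to the constant `P 0` centres `v`. Splitting over the value `y` of `N (s + t)`, the Markov
property and stationarity reduce this to the identity

  `∑ x, m x * v x * p t x y = exp (λ₁ t) * m y * v y`   (`IsSolvable.hasSum_mul_column`).

Its left-hand side `φ t` satisfies `φ' = λ₁ φ`. Indeed, the transition function solves the backward
equation `∂ₜ p t x y = 𝒢 (p t · y) x`
(`IsBirthDeathTransition.hasDerivWithinAt_column`), because the rates from a state sum to
zero, which leaves no room for long jumps in the limit. By the Pearson equation, which is detailed
balance, `𝒢` is symmetric with respect to `m`, and moving it from the bounded function `p t · y` to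
`v` gives the factor `λ₁` (`IsSolvable.hasSum_mul_generator`). Neither the spectral decomposition
of `𝒢` in `ℓ²(𝔪)` nor convergence of `exp (t 𝒢)` is involved.

All exchanges of limit and sum, and the absence of boundary terms at infinity, come from one
summable bound, `m x * (b x + d x) * (1 + |v x|)` (`IsSolvable.summable_rates_mul`): the rates are
polynomials, and if `E` is infinite the `P n` span all polynomials, so these are in `L²(𝔪)`. The
time increments of `p t x y` are controlled by `1 - p t x x ≤ (b x + d x) * t`
(`IsBirthDeathTransition.one_sub_le`).
-/

namespace BirthDeath

/-! ### The backward equation -/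

section Transition

variable {E : Set ℕ} {b d : ℕ → ℝ} {p : ℝ≥0 → ℕ → ℕ → ℝ}

theorem IsBirthDeathTransition.hasSum_row (hp : IsBirthDeathTransition E b d p) (t : ℝ≥0) {x : ℕ}
    (hx : x ∈ E) : HasSum (E.indicator (p t x)) 1 :=
  hasSum_subtype_iff_indicator.1 (hp.sum_one t x hx)

theorem IsBirthDeathTransition.row_nonneg (hp : IsBirthDeathTransition E b d p) (t : ℝ≥0) {x : ℕ}
    (hx : x ∈ E) (y : ℕ) : 0 ≤ E.indicator (p t x) y :=
  Set.indicator_nonneg (fun y hy => hp.nonneg t x hx y hy) y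

theorem IsBirthDeathTransition.le_one (hp : IsBirthDeathTransition E b d p) (t : ℝ≥0) {x y : ℕ}
    (hx : x ∈ E) (hy : y ∈ E) : p t x y ≤ 1 := by
  have h := le_hasSum (hp.hasSum_row t hx) y fun z _ => hp.row_nonneg t hx z
  rwa [Set.indicator_of_mem hy] at h

/-- The column `x ↦ p t x y` of the transition function, extended by zero off `E` and with real
time, so that it can be differentiated in `t`. -/
noncomputable def column (E : Set ℕ) (p : ℝ≥0 → ℕ → ℕ → ℝ) (y : ℕ) (t : ℝ) : ℕ → ℝ :=
  E.indicator fun x => p t.toNNReal x y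

theorem column_of_mem {y : ℕ} (t : ℝ) {x : ℕ} (hx : x ∈ E) :
    column E p y t x = p t.toNNReal x y :=
  Set.indicator_of_mem hx _

theorem IsBirthDeathTransition.column_nonneg (hp : IsBirthDeathTransition E b d p) {y : ℕ}
    (hy : y ∈ E) (t : ℝ) (x : ℕ) : 0 ≤ column E p y t x :=
  Set.indicator_nonneg (fun x hx => hp.nonneg _ x hx y hy) x

theorem IsBirthDeathTransition.column_le_one (hp : IsBirthDeathTransition E b d p) {y : ℕ}
    (hy : y ∈ E) (t : ℝ) (x : ℕ) : column E p y t x ≤ 1 :=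
  Set.indicator_le' (fun _ hx => hp.le_one _ hx hy) (fun _ _ => zero_le_one) x

theorem IsBirthDeathTransition.hasSum_row_mul_column (hp : IsBirthDeathTransition E b d p)
    {x y : ℕ} (hx : x ∈ E) (hy : y ∈ E) {s t : ℝ} (hs : 0 ≤ s) (ht : 0 ≤ t) :
    HasSum (fun z => E.indicator (p s.toNNReal x) z * column E p y t z)
      (column E p y (s + t) x) := by
  have h := (hasSum_subtype_iff_indicator
    (f := fun z => p s.toNNReal x z * p t.toNNReal z y)).1
    (hp.chapman_kolmogorov s.toNNReal t.toNNReal x hx y hy)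
  rw [column_of_mem _ hx, Real.toNNReal_add hs ht]
  refine HasSum.congr_fun h fun z => ?_
  by_cases hz : z ∈ E <;> simp [hz, column]

/-- For a function with values in `[0, 1]`, the transition operator at time `h` changes the value
at `x` by at most the probability of not being at `x` at time `h`. -/
theorem IsBirthDeathTransition.abs_sub_le (hp : IsBirthDeathTransition E b d p) {x : ℕ}
    (hx : x ∈ E) (h : ℝ≥0) {w : ℕ → ℝ} (hw0 : ∀ z, 0 ≤ w z) (hw1 : ∀ z, w z ≤ 1) {S : ℝ}
    (hS : HasSum (fun z => E.indicator (p h x) z * w z) S) :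
    |S - w x| ≤ 1 - p h x x := by
  have hx1 := hp.le_one h hx hx
  have hlow : p h x x * w x ≤ S := by
    have := le_hasSum hS x fun z _ => mul_nonneg (hp.row_nonneg h hx z) (hw0 z)
    simpa [hx] using this
  have hup : p h x x * (1 - w x) ≤ 1 - S := by
    have h1 : HasSum (fun z => E.indicator (p h x) z * (1 - w z)) (1 - S) := by
      simpa [mul_sub] using (hp.hasSum_row h hx).sub hS
    have := le_hasSum h1 x fun z _ =>
      mul_nonneg (hp.row_nonneg h hx z) (sub_nonneg.2 (hw1 z))
    simpa [hx] using this
  rw [abs_le]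
  constructor <;> nlinarith [hw0 x, hw1 x]

/-- The probability of leaving `x` within time `t` is subadditive in `t`, so it is at most `t`
times its derivative at `0`. -/
theorem IsBirthDeathTransition.one_sub_le (hp : IsBirthDeathTransition E b d p) {x : ℕ}
    (hx : x ∈ E) (t : ℝ≥0) : 1 - p t x x ≤ (b x + d x) * t := by
  have hsub : ∀ s t : ℝ≥0, 1 - p (s + t) x x ≤ (1 - p s x x) + (1 - p t x x) := fun s t => by
    have h := le_hasSum (hp.chapman_kolmogorov s t x hx x hx) ⟨x, hx⟩ fun z _ =>
      mul_nonneg (hp.nonneg s x hx z z.2) (hp.nonneg t z z.2 x hx)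
    simp only at h
    nlinarith [hp.le_one s hx hx, hp.le_one t hx hx]
  have hmul : ∀ (n : ℕ) (s : ℝ≥0), 1 - p (n * s) x x ≤ n * (1 - p s x x) := fun n s => by
    induction n with
    | zero => simp [hp.zero_time x hx x hx]
    | succ n ih =>
      have := hsub (n * s) s
      push_cast
      rw [add_mul, add_mul, one_mul, one_mul]
      linarith
  rcases eq_or_ne t 0 with rfl | ht
  · simp [hp.zero_time x hx x hx]
  have ht0 : 0 < t := pos_iff_ne_zero.2 ht
  have hlim : Tendsto (fun n : ℕ => t / (n + 1 : ℝ≥0)) atTop (𝓝[>] 0) := by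
    refine tendsto_nhdsWithin_iff.2 ⟨?_, Eventually.of_forall fun n => ?_⟩
    · rw [← NNReal.tendsto_coe]
      have := (tendsto_const_nhds (x := (t : ℝ))).mul tendsto_one_div_add_atTop_nhds_zero_nat
      simpa [div_eq_mul_inv] using this
    · exact div_pos ht0 (by positivity)
  have h1 := ((hp.infinitesimal x hx x hx).comp hlim).neg.mul_const (t : ℝ)
  have hr : -rate b d x x * t = (b x + d x) * t := by simp [rate]
  rw [hr] at h1
  refine ge_of_tendsto' h1 fun n => ?_
  have h2 := hmul (n + 1) (t / (n + 1 : ℝ≥0))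
  have hn : ((n + 1 : ℕ) : ℝ≥0) * (t / (n + 1 : ℝ≥0)) = t := by
    push_cast
    exact mul_div_cancel₀ _ (by positivity)
  rw [hn] at h2
  refine h2.trans (le_of_eq ?_)
  have htr : (t : ℝ) ≠ 0 := by exact_mod_cast ht
  have hnr : (n + 1 : ℝ) ≠ 0 := by positivity
  simp only [Function.comp, hp.zero_time x hx x hx, if_true]
  push_cast
  field_simp
  ring

theorem IsBirthDeathTransition.abs_column_sub_le (hp : IsBirthDeathTransition E b d p) {x y : ℕ}
    (hx : x ∈ E) (hy : y ∈ E) {s t : ℝ} (hs : 0 ≤ s) (hst : s ≤ t) :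
    |column E p y t x - column E p y s x| ≤ (b x + d x) * (t - s) := by
  have h := hp.hasSum_row_mul_column hx hy (sub_nonneg.2 hst) hs
  rw [sub_add_cancel] at h
  refine (hp.abs_sub_le hx _ (hp.column_nonneg hy s) (hp.column_le_one hy s) h).trans ?_
  have := hp.one_sub_le hx (t - s).toNNReal
  rwa [Real.coe_toNNReal _ (sub_nonneg.2 hst)] at this

/-- At the ends of `E` the neighbour off `E` carries the rate `b x = 0` or `d 0 = 0`, so the
generator only sees values on `E`. -/
theorem IsRates.sum_rate_mul (hr : IsRates E b d) {x : ℕ} (hx : x ∈ E) (w : ℕ → ℝ) :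
    ∑ z ∈ Finset.Icc (x - 1) (x + 1), E.indicator (rate b d x) z * w z = generator b d w x := by
  have hlast : E.indicator (rate b d x) (x + 1) = b x := by
    by_cases h : x + 1 ∈ E
    · simp [h, rate]
    · simp [h, hr.birth_last x hx h]
  have hself : E.indicator (rate b d x) x = -(b x + d x) := by simp [hx, rate]
  rcases x with _ | x
  · have hI : Finset.Icc (0 - 1) (0 + 1) = ({0, 1} : Finset ℕ) := by decide
    rw [hI, Finset.sum_pair (by decide), hself]
    rw [zero_add] at hlast
    rw [hlast]
    simp [generator, nablaPlus, hr.death_zero]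
    ring
  · have hI : Finset.Icc (x + 1 - 1) (x + 1 + 1) = ({x, x + 1, x + 1 + 1} : Finset ℕ) := by
      ext z
      simp only [Finset.mem_Icc, Finset.mem_insert, Finset.mem_singleton]
      omega
    have hxE : x ∈ E := hr.segment.out hr.zero_mem hx ⟨Nat.zero_le _, Nat.le_succ _⟩
    have hfirst : E.indicator (rate b d (x + 1)) x = d (x + 1) := by
      simp only [Set.indicator_of_mem hxE, rate, if_true]
      rw [if_neg (by omega)]
    rw [hI, Finset.sum_insert (by simp; omega), Finset.sum_pair (by simp), hself, hlast, hfirst]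
    simp [generator, nablaPlus, centralDiff]
    ring

/-- The generator is the right derivative at time `0` of the transition operators on bounded
functions. The jumps of size at least two contribute nothing in the limit, because the rates from
`x` to its neighbours and to itself already sum to zero. -/
theorem IsBirthDeathTransition.tendsto_div (hp : IsBirthDeathTransition E b d p) {x : ℕ}
    (hx : x ∈ E) {w : ℕ → ℝ} (hw0 : ∀ z, 0 ≤ w z) (hw1 : ∀ z, w z ≤ 1) {S : ℝ≥0 → ℝ}
    (hS : ∀ h, HasSum (fun z => E.indicator (p h x) z * w z) (S h)) :
    Tendsto (fun h : ℝ≥0 => (S h - w x) / h) (𝓝[>] 0) (𝓝 (generator b d w x)) := by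
  classical
  set F : Finset ℕ := Finset.Icc (x - 1) (x + 1) with hF
  have hxF : x ∈ F := by simp [hF]
  let D : ℝ≥0 → ℕ → ℝ := fun h z => (E.indicator (p h x) z - E.indicator (p 0 x) z) / h
  have hp0 : E.indicator (p 0 x) = fun z => if z = x then 1 else 0 := by
    ext z
    by_cases hz : z ∈ E
    · simp [hz, hp.zero_time x hx z hz]
    · have : z ≠ x := fun h => hz (h ▸ hx)
      simp [hz, this]
  have hDlim : ∀ z, Tendsto (fun h => D h z) (𝓝[>] 0) (𝓝 (E.indicator (rate b d x) z)) := by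
    intro z
    by_cases hz : z ∈ E
    · simpa [D, hz] using hp.infinitesimal x hx z hz
    · simp [D, hz]
  have hDsum : ∀ h, HasSum (D h) 0 := fun h => by
    simpa using ((hp.hasSum_row h hx).sub (hp.hasSum_row 0 hx)).div_const (h : ℝ)
  have hDw : ∀ h, HasSum (fun z => D h z * w z) ((S h - w x) / h) := fun h => by
    have h0 : HasSum (fun z => E.indicator (p 0 x) z * w z) (w x) := by
      have h1 := hasSum_single (f := fun z => E.indicator (p 0 x) z * w z) x
        fun z hz => by simp [hp0, hz]
      simpa [hp0] using h1
    refine HasSum.congr_fun (((hS h).sub h0).div_const (h : ℝ)) fun z => ?_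
    simp only [D]
    ring
  have hDnonneg : ∀ h, ∀ z ∉ F, 0 ≤ D h z := fun h z hz => by
    have : z ≠ x := fun h => hz (h ▸ hxF)
    simp only [D, hp0, this, if_false, sub_zero]
    exact div_nonneg (hp.row_nonneg h hx z) h.2
  have hFlim : Tendsto (fun h => ∑ z ∈ F, D h z * w z) (𝓝[>] 0) (𝓝 (generator b d w x)) := by
    rw [← hp.rates.sum_rate_mul hx]
    exact tendsto_finsetSum _ fun z _ => (hDlim z).mul_const _
  have hFlim0 : Tendsto (fun h => -∑ z ∈ F, D h z) (𝓝[>] 0) (𝓝 0) := by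
    have h1 : generator b d (fun _ => (1 : ℝ)) x = 0 := by
      simp [generator, nablaPlus, centralDiff]
      norm_num
    have h2 := hp.rates.sum_rate_mul hx fun _ => (1 : ℝ)
    rw [h1] at h2
    have h3 := (tendsto_finsetSum F fun z _ => (hDlim z)).neg
    simp only [mul_one] at h2
    rwa [h2, neg_zero] at h3
  have hdiff : ∀ h, |(S h - w x) / h - ∑ z ∈ F, D h z * w z| ≤ -∑ z ∈ F, D h z := fun h => by
    have t1 : HasSum (fun z => if z ∈ F then 0 else D h z) (0 - ∑ z ∈ F, D h z) := by
      have := (hDsum h).sub (hasSum_sum_of_ne_finset_zero (f := fun z => if z ∈ F then D h z else 0)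
        (s := F) (by intro z hz; simp [hz]))
      rw [Finset.sum_congr rfl fun z hz => if_pos hz] at this
      refine HasSum.congr_fun this fun z => ?_
      split_ifs <;> simp
    have t2 : HasSum (fun z => (if z ∈ F then 0 else D h z) * w z)
        ((S h - w x) / h - ∑ z ∈ F, D h z * w z) := by
      have := (hDw h).sub (hasSum_sum_of_ne_finset_zero
        (f := fun z => if z ∈ F then D h z * w z else 0)
        (s := F) (by intro z hz; simp [hz]))
      rw [Finset.sum_congr rfl fun z hz => if_pos hz] at this
      refine HasSum.congr_fun this fun z => ?_
      split_ifs <;> simp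
    have hnn : ∀ z, 0 ≤ (if z ∈ F then 0 else D h z) := fun z => by
      split_ifs with hz
      · exact le_rfl
      · exact hDnonneg h z hz
    rw [abs_of_nonneg (t2.nonneg fun z => mul_nonneg (hnn z) (hw0 z)), ← zero_sub]
    exact hasSum_le (fun z => mul_le_of_le_one_right (hnn z) (hw1 z)) t2 t1
  have := (squeeze_zero_norm hdiff hFlim0).add hFlim
  simpa using this

/-- Kolmogorov's backward equation, for the right derivative. -/
theorem IsBirthDeathTransition.hasDerivWithinAt_column (hp : IsBirthDeathTransition E b d p)
    {x y : ℕ} (hx : x ∈ E) (hy : y ∈ E) {t : ℝ} (ht : 0 ≤ t) :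
    HasDerivWithinAt (fun s => column E p y s x) (generator b d (column E p y t) x)
      (Set.Ici t) t := by
  rw [← hasDerivWithinAt_Ioi_iff_Ici, hasDerivWithinAt_iff_tendsto_slope' (by simp)]
  have hS : ∀ h : ℝ≥0, HasSum (fun z => E.indicator (p h x) z * column E p y t z)
      (column E p y (h + t) x) := fun h => by
    simpa using hp.hasSum_row_mul_column hx hy h.2 ht
  have h1 := hp.tendsto_div hx (hp.column_nonneg hy t) (hp.column_le_one hy t) hS
  have h2 : Tendsto (fun s : ℝ => (s - t).toNNReal) (𝓝[>] t) (𝓝[>] 0) := by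
    refine tendsto_nhdsWithin_iff.2 ⟨?_, ?_⟩
    · have : ContinuousAt (fun s : ℝ => (s - t).toNNReal) t := by fun_prop
      simpa using this.tendsto.mono_left nhdsWithin_le_nhds
    · filter_upwards [self_mem_nhdsWithin] with s hs
      simpa using hs
  refine (h1.comp h2).congr' ?_
  filter_upwards [self_mem_nhdsWithin] with s hs
  have hst : 0 ≤ s - t := sub_nonneg.2 (le_of_lt hs)
  simp [slope_def_field, Real.coe_toNNReal _ hst]

end Transition

/-! ### Detailed balance and symmetry of the generator -/

section Symmetry

theorem hasSum_real_singleton_mul {𝔪 : Measure ℕ} {f : ℕ → ℝ} (hf : Integrable f 𝔪) :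
    HasSum (fun x => 𝔪.real {x} * f x) (∫ x, f x ∂𝔪) := by
  have h := hasSum_integral_iUnion (μ := 𝔪) (f := f) (s := fun x : ℕ => {x})
    (fun x => measurableSet_singleton x) (fun x y hxy => by simpa using hxy) (by
      simpa using hf.integrableOn)
  simp only [Set.iUnion_of_singleton, Measure.restrict_univ, integral_singleton, smul_eq_mul] at h
  exact h

/-- Summation by parts: under detailed balance the generator is the symmetric Dirichlet form, as
soon as the terms of the sum are separately summable. -/
theorem hasSum_mul_generator {b d m f g : ℕ → ℝ} (hd0 : d 0 = 0)
    (hbal : ∀ x, d (x + 1) * m (x + 1) = b x * m x)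
    (hb : Summable fun x => m x * b x * (f x * (g (x + 1) - g x)))
    (hd : Summable fun x => m x * d x * (f x * (g (x - 1) - g x))) :
    HasSum (fun x => m x * (f x * generator b d g x))
      (-∑' x, m x * b x * ((f (x + 1) - f x) * (g (x + 1) - g x))) := by
  have hd1 := (hasSum_nat_add_iff' 1).2 hd.hasSum
  simp only [Finset.range_one, Finset.sum_singleton, hd0, mul_zero, zero_mul, sub_zero,
    Nat.add_sub_cancel] at hd1
  have h1 := hb.hasSum.add hd1
  have h2 : HasSum (fun x => m x * b x * ((f (x + 1) - f x) * (g (x + 1) - g x)))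
      (-((∑' x, m x * b x * (f x * (g (x + 1) - g x))) +
        ∑' x, m x * d x * (f x * (g (x - 1) - g x)))) :=
    h1.neg.congr_fun fun x => by
      linear_combination (f (x + 1) * (g (x + 1) - g x)) * -hbal x
  rw [h2.tsum_eq, neg_neg]
  refine (hb.hasSum.add hd.hasSum).congr_fun fun x => ?_
  simp only [generator, nablaPlus, centralDiff, smul_eq_mul, nsmul_eq_mul, Nat.cast_ofNat]
  ring

variable {E : Set ℕ} {b d : ℕ → ℝ} {p : ℝ≥0 → ℕ → ℕ → ℝ} {𝔪 : Measure ℕ} {lam : ℕ → ℝ}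
  {P : ℕ → ℝ[X]}

theorem IsInvariant.real_singleton_eq_zero (h : IsInvariant E p 𝔪) {x : ℕ} (hx : x ∉ E) :
    𝔪.real {x} = 0 := by
  rw [measureReal_def, measure_mono_null (by simpa using hx) h.carrier, ENNReal.toReal_zero]

/-- The Pearson equation is detailed balance. -/
theorem IsSolvable.detailed_balance (hs : IsSolvable E b d p 𝔪 lam P) (hr : IsRates E b d)
    (x : ℕ) : d (x + 1) * 𝔪.real {x + 1} = b x * 𝔪.real {x} := by
  by_cases hx : x ∈ E
  · have := hs.pearson x hx
    simp only [nablaPlus] at this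
    linarith
  · have hx1 : x + 1 ∉ E := fun h =>
      hx (hr.segment.out hr.zero_mem h ⟨Nat.zero_le _, Nat.le_succ _⟩)
    rw [hs.invariant.real_singleton_eq_zero hx, hs.invariant.real_singleton_eq_zero hx1]
    simp

/-- On an infinite state space the polynomials `P n` span all polynomials, and on a finite one
every function is bounded. -/
theorem IsSolvable.memLp_eval (hs : IsSolvable E b d p 𝔪 lam P) (hr : IsRates E b d) (Q : ℝ[X]) :
    MemLp (fun x : ℕ => Q.eval (x : ℝ)) 2 𝔪 := by
  have := hs.invariant.isProbability
  by_cases hE : ∀ n, n ∈ E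
  · let S : Polynomial.Sequence ℝ := ⟨P, fun n => hs.degree_eq n (hE n)⟩
    have hspan := S.span fun n => (S.ne_zero n |> leadingCoeff_ne_zero.2).isUnit
    have hQ : Q ∈ Submodule.span ℝ (Set.range S) := hspan ▸ Submodule.mem_top
    induction hQ using Submodule.span_induction with
    | mem R hR =>
      obtain ⟨n, rfl⟩ := hR
      exact hs.square_integrable n (hE n)
    | zero => simp
    | add R R' _ _ h h' =>
      simp only [eval_add]
      exact h.add h'
    | smul a R _ h =>
      simp only [eval_smul]
      exact h.const_smul a
  · push Not at hE
    obtain ⟨n, hn⟩ := hE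
    refine MemLp.of_bound (by fun_prop) (∑ x ∈ Finset.range n, ‖Q.eval (x : ℝ)‖) ?_
    have hae : ∀ᵐ x ∂𝔪, x ∈ E := hs.invariant.carrier
    filter_upwards [hae] with x hx
    have hxn : x < n := by
      by_contra! hnx
      exact hn (hr.segment.out hr.zero_mem hx ⟨Nat.zero_le _, hnx⟩)
    exact Finset.single_le_sum (f := fun x : ℕ => ‖Q.eval (x : ℝ)‖)
      (fun _ _ => norm_nonneg _) (Finset.mem_range.2 hxn)

theorem IsSolvable.memLp_add_const (hs : IsSolvable E b d p 𝔪 lam P) (hr : IsRates E b d)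
    (c : ℝ) : MemLp (fun x : ℕ => (x : ℝ) + c) 2 𝔪 := by
  have h := hs.memLp_eval hr (X + C c)
  simp only [eval_add, eval_X, eval_C] at h
  exact h

/-- The rates agree on `E` with polynomials, and all polynomials are in `L²(𝔪)`. This sequence
dominates the sums arising in the summation by parts and in the differentiation in time. -/
theorem IsSolvable.summable_rates_mul (hs : IsSolvable E b d p 𝔪 lam P) (hr : IsRates E b d)
    (c : ℝ) : Summable fun x : ℕ => 𝔪.real {x} * ((b x + d x) * (1 + |(x : ℝ) + c|)) := by
  have := hs.invariant.isProbability
  obtain ⟨D, -, hD⟩ := hs.death_poly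
  obtain ⟨T, -, hT⟩ := hs.drift_poly
  have h1 : MemLp (fun x : ℕ => 1 + |(x : ℝ) + c|) 2 𝔪 :=
    (memLp_const (1 : ℝ)).add (hs.memLp_add_const hr c).abs
  refine (hasSum_real_singleton_mul
    ((hs.memLp_eval hr (T + 2 * D)).integrable_mul h1)).summable.congr fun x => ?_
  by_cases hx : x ∈ E
  · have e : b x + d x = T.eval (x : ℝ) + 2 * D.eval (x : ℝ) := by
      rw [← hD x hx, ← hT x hx]
      ring
    simp [e]
  · simp [hs.invariant.real_singleton_eq_zero hx]

theorem IsSolvable.abs_rates_mul_le (hs : IsSolvable E b d p 𝔪 lam P) (hr : IsRates E b d)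
    {x : ℕ} {k l : ℝ} (hk : |k| ≤ l) :
    |𝔪.real {x} * b x * k| ≤ 𝔪.real {x} * ((b x + d x) * l) ∧
      |𝔪.real {x} * d x * k| ≤ 𝔪.real {x} * ((b x + d x) * l) := by
  by_cases hx : x ∈ E
  · have hm : 0 ≤ 𝔪.real {x} := measureReal_nonneg
    have hb := hr.birth_nonneg x hx
    have hd := hr.death_nonneg x hx
    have hl := (abs_nonneg k).trans hk
    rw [mul_assoc, mul_assoc, abs_mul, abs_mul, abs_mul, abs_mul, abs_of_nonneg hm,
      abs_of_nonneg hb, abs_of_nonneg hd]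
    constructor <;> refine mul_le_mul_of_nonneg_left ?_ hm <;>
      nlinarith [mul_le_mul_of_nonneg_left hk hb, mul_le_mul_of_nonneg_left hk hd,
        mul_nonneg hb hl, mul_nonneg hd hl]
  · simp [hs.invariant.real_singleton_eq_zero hx]

theorem IsSolvable.summable_rates_mul_of_abs_le (hs : IsSolvable E b d p 𝔪 lam P)
    (hr : IsRates E b d) (c : ℝ) {k : ℕ → ℝ} (hk : ∀ x : ℕ, |k x| ≤ 1 + |(x : ℝ) + c|) :
    (Summable fun x => 𝔪.real {x} * b x * k x) ∧ Summable fun x => 𝔪.real {x} * d x * k x :=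
  ⟨.of_norm_bounded (hs.summable_rates_mul hr c) fun x => (hs.abs_rates_mul_le hr (hk x)).1,
    .of_norm_bounded (hs.summable_rates_mul hr c) fun x => (hs.abs_rates_mul_le hr (hk x)).2⟩

/-- A linear eigenfunction can be moved across the generator when tested against a bounded
function. -/
theorem IsSolvable.hasSum_mul_generator (hs : IsSolvable E b d p 𝔪 lam P) (hr : IsRates E b d)
    {c l : ℝ} (hc : ∀ x ∈ E, generator b d (fun x : ℕ => (x : ℝ) + c) x = l * (x + c))
    {u : ℕ → ℝ} (hu0 : ∀ x, 0 ≤ u x) (hu1 : ∀ x, u x ≤ 1) :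
    HasSum (fun x : ℕ => 𝔪.real {x} * ((x + c) * generator b d u x))
      (l * ∑' x : ℕ, 𝔪.real {x} * ((x + c) * u x)) := by
  have hdiff : ∀ x y, |u x - u y| ≤ 1 := fun x y => by
    rw [abs_le]
    constructor <;> linarith [hu0 x, hu1 x, hu0 y, hu1 y]
  have hv : ∀ x y : ℕ, |((x : ℝ) + c) * (u y - u x)| ≤ 1 + |(x : ℝ) + c| := fun x y => by
    rw [abs_mul]
    nlinarith [hdiff y x, abs_nonneg ((x : ℝ) + c)]
  have huv : ∀ (x : ℕ) (e : ℝ), |e| ≤ 1 → |u x * e| ≤ 1 + |(x : ℝ) + c| := fun x e he => by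
    rw [abs_mul, abs_of_nonneg (hu0 x)]
    nlinarith [abs_nonneg ((x : ℝ) + c), hu0 x, hu1 x, abs_nonneg e]
  have h1 := BirthDeath.hasSum_mul_generator (m := fun x => 𝔪.real {x})
    (f := fun x : ℕ => (x : ℝ) + c) (g := u) hr.death_zero (hs.detailed_balance hr)
    (hs.summable_rates_mul_of_abs_le hr c fun x => hv x (x + 1)).1
    (hs.summable_rates_mul_of_abs_le hr c fun x => hv x (x - 1)).2
  have h2 := BirthDeath.hasSum_mul_generator (m := fun x => 𝔪.real {x})
    (g := fun x : ℕ => (x : ℝ) + c) (f := u) hr.death_zero (hs.detailed_balance hr)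
    (hs.summable_rates_mul_of_abs_le hr c fun x => huv x _ (by simp)).1
    (hs.summable_rates_mul_of_abs_le hr c fun x => huv x _ (by
      rcases x with _ | x <;> simp)).2
  have h3 : ∑' x : ℕ, 𝔪.real {x} * (u x * generator b d (fun x : ℕ => (x : ℝ) + c) x) =
      l * ∑' x : ℕ, 𝔪.real {x} * ((x + c) * u x) := by
    rw [← tsum_mul_left]
    refine tsum_congr fun x => ?_
    by_cases hx : x ∈ E
    · rw [hc x hx]
      ring
    · simp [hs.invariant.real_singleton_eq_zero hx]
  rw [← h3, h2.tsum_eq]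
  refine (congrArg (HasSum _ ·) ?_).mp h1
  simp_rw [mul_comm (u _ - u _)]

/-! ### Exponential decay of the linear eigenfunction -/

theorem eq_exp_mul_of_hasDerivWithinAt {f : ℝ → ℝ} {l : ℝ} (hf : ContinuousOn f (Set.Ici 0))
    (hf' : ∀ t, 0 ≤ t → HasDerivWithinAt f (l * f t) (Set.Ici t) t) {t : ℝ} (ht : 0 ≤ t) :
    f t = Real.exp (l * t) * f 0 := by
  have h := constant_of_has_deriv_right_zero (f := fun s => Real.exp (-(l * s)) * f s)
    (a := 0) (b := t)
    ((by fun_prop : Continuous fun s => Real.exp (-(l * s))).continuousOn.mul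
      (hf.mono Set.Icc_subset_Ici_self)) (fun s hs => by
      have h1 : HasDerivAt (fun s => Real.exp (-(l * s))) (Real.exp (-(l * s)) * -(l * 1)) s :=
        ((hasDerivAt_id s).const_mul l).neg.exp
      have h2 := h1.hasDerivWithinAt.mul (hf' s hs.1)
      exact h2.congr_deriv (by ring)) t ⟨ht, le_rfl⟩
  simp only [mul_zero, neg_zero, Real.exp_zero, one_mul] at h
  rw [← h, ← mul_assoc, ← Real.exp_add]
  simp

/-- The linear eigenfunction decays exponentially in the dual form: the derivative in `t` of the
left-hand side is computed from the backward equation, and symmetry moves the generator to the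
eigenfunction. -/
theorem IsSolvable.hasSum_mul_column (hs : IsSolvable E b d p 𝔪 lam P)
    (hp : IsBirthDeathTransition E b d p)
    {c l : ℝ} (hc : ∀ x ∈ E, generator b d (fun x : ℕ => (x : ℝ) + c) x = l * (x + c))
    {y : ℕ} (hy : y ∈ E) {t : ℝ} (ht : 0 ≤ t) :
    HasSum (fun x : ℕ => 𝔪.real {x} * ((x + c) * column E p y t x))
      (Real.exp (l * t) * (𝔪.real {y} * (y + c))) := by
  have := hs.invariant.isProbability
  have hr := hp.rates
  -- `W x` bounds the Lipschitz constant in `t` of the `x`-th term of the sum.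
  set W : ℕ → ℝ := fun x => 𝔪.real {x} * ((b x + d x) * (1 + |(x : ℝ) + c|)) with hW
  have hWs : Summable W := hs.summable_rates_mul hr c
  let φ : ℝ → ℝ := fun t => ∑' x : ℕ, 𝔪.real {x} * ((x + c) * column E p y t x)
  have hsum : ∀ t, Summable fun x : ℕ => 𝔪.real {x} * ((x + c) * column E p y t x) := fun t => by
    have h := (hasSum_real_singleton_mul
      ((hs.memLp_add_const hr c).integrable one_le_two).abs).summable
    refine .of_norm_bounded h fun x => ?_
    rw [Real.norm_eq_abs, abs_mul, abs_mul, abs_of_nonneg measureReal_nonneg,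
      abs_of_nonneg (hp.column_nonneg hy t x)]
    exact mul_le_mul_of_nonneg_left
      (mul_le_of_le_one_right (abs_nonneg _) (hp.column_le_one hy t x)) measureReal_nonneg
  have hlip : ∀ s t, 0 ≤ s → s ≤ t → ∀ x : ℕ,
      |𝔪.real {x} * ((x + c) * (column E p y t x - column E p y s x))| ≤ W x * (t - s) := by
    intro s t hs0 hst x
    by_cases hx : x ∈ E
    · have h1 := hp.abs_column_sub_le hx hy hs0 hst
      have h2 : 0 ≤ (b x + d x) * (t - s) := (abs_nonneg _).trans h1
      rw [abs_mul, abs_mul, abs_of_nonneg measureReal_nonneg, hW]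
      simp only [mul_assoc]
      refine mul_le_mul_of_nonneg_left ?_ measureReal_nonneg
      nlinarith [mul_le_mul_of_nonneg_left h1 (abs_nonneg ((x : ℝ) + c))]
    · simp [hW, hs.invariant.real_singleton_eq_zero hx]
  have hφsub : ∀ s t, φ t - φ s =
      ∑' x : ℕ, 𝔪.real {x} * ((x + c) * (column E p y t x - column E p y s x)) := fun s t => by
    rw [← (hsum t).tsum_sub (hsum s)]
    exact tsum_congr fun x => by ring
  have hφlip : ∀ s t, 0 ≤ s → s ≤ t → |φ t - φ s| ≤ (∑' x, W x) * |t - s| := by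
    intro s t hs0 hst
    rw [hφsub, abs_of_nonneg (sub_nonneg.2 hst), ← tsum_mul_right]
    exact tsum_of_norm_bounded (f := fun x : ℕ =>
      𝔪.real {x} * ((x + c) * (column E p y t x - column E p y s x)))
      (hWs.mul_right _).hasSum (hlip s t hs0 hst)
  have hφcont : ContinuousOn φ (Set.Ici 0) := by
    have hWn : 0 ≤ ∑' x, W x := by
      have := hφlip 0 1 le_rfl zero_le_one
      simp only [sub_zero, abs_one, mul_one] at this
      exact (abs_nonneg _).trans this
    refine LipschitzOnWith.continuousOn (K := (∑' x, W x).toNNReal)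
      (LipschitzOnWith.of_dist_le_mul fun s hs0 t ht0 => ?_)
    rw [Real.coe_toNNReal _ hWn, Real.dist_eq, Real.dist_eq]
    rcases le_total s t with h | h
    · rw [abs_sub_comm, abs_sub_comm s]
      exact hφlip s t hs0 h
    · exact hφlip t s ht0 h
  have hφderiv : ∀ t, 0 ≤ t → HasDerivWithinAt φ (l * φ t) (Set.Ici t) t := by
    intro t ht
    have hG := hs.hasSum_mul_generator hr hc (hp.column_nonneg hy t) (hp.column_le_one hy t)
    rw [← hasDerivWithinAt_Ioi_iff_Ici, hasDerivWithinAt_iff_tendsto_slope' (by simp),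
      ← hG.tsum_eq]
    have hlim := tendsto_tsum_of_dominated_convergence (𝓕 := 𝓝[>] t)
      (f := fun s (x : ℕ) => 𝔪.real {x} * ((x + c) * slope (fun s => column E p y s x) t s))
      (g := fun x : ℕ => 𝔪.real {x} * ((x + c) * generator b d (column E p y t) x)) hWs
      (fun x => by
        by_cases hx : x ∈ E
        · have h := hp.hasDerivWithinAt_column hx hy ht
          rw [← hasDerivWithinAt_Ioi_iff_Ici, hasDerivWithinAt_iff_tendsto_slope' (by simp)] at h
          exact (h.const_mul _).const_mul _
        · simp [hs.invariant.real_singleton_eq_zero hx])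
      (by
        filter_upwards [self_mem_nhdsWithin] with s hts x
        have hpos : 0 < s - t := sub_pos.2 hts
        have h := hlip t s ht (le_of_lt hts) x
        rw [slope_def_field, ← mul_div_assoc, ← mul_div_assoc, Real.norm_eq_abs, abs_div,
          abs_of_pos hpos, div_le_iff₀ hpos]
        exact h)
    refine hlim.congr fun s => ?_
    rw [slope_def_field, hφsub, ← tsum_div_const]
    refine tsum_congr fun x => ?_
    rw [slope_def_field]
    ring
  have hφ0 : φ 0 = 𝔪.real {y} * (y + c) := by
    refine (tsum_eq_single y fun x hxy => ?_).trans ?_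
    · by_cases hx : x ∈ E
      · simp [column_of_mem _ hx, hp.zero_time x hx y hy, hxy.symm]
      · simp [column, hx]
    · simp [column_of_mem _ hy, hp.zero_time y hy y hy]
  rw [← hφ0, ← eq_exp_mul_of_hasDerivWithinAt hφcont hφderiv ht]
  exact (hsum t).hasSum

/-- The eigenfunction `P 1`, made monic, is `x + c`; it is centred because it is orthogonal to
the constant `P 0`. -/
theorem IsSolvable.exists_linear_eigenfunction (hs : IsSolvable E b d p 𝔪 lam P)
    (h0 : 0 ∈ E) (h1 : 1 ∈ E) :
    ∃ c : ℝ, (∀ x ∈ E, generator b d (fun x : ℕ => (x : ℝ) + c) x = lam 1 * (x + c)) ∧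
      ∫ x : ℕ, ((x : ℝ) + c) ∂𝔪 = 0 := by
  have hd1 : (P 1).degree = 1 := by simpa using hs.degree_eq 1 h1
  have hd0 : (P 0).degree = 0 := by simpa using hs.degree_eq 0 h0
  obtain ⟨a, ha, c, hP⟩ : ∃ a : ℝ, a ≠ 0 ∧ ∃ c, P 1 = C a * X + C c :=
    ⟨(P 1).coeff 1, coeff_ne_zero_of_eq_degree hd1, (P 1).coeff 0,
      eq_X_add_C_of_degree_le_one hd1.le⟩
  have heval : ∀ x : ℕ, (P 1).eval (x : ℝ) = a * (x + c / a) := fun x => by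
    simp [hP]
    field_simp
  refine ⟨c / a, fun x hx => mul_left_cancel₀ ha ?_, ?_⟩
  · have h := hs.eigenfunction 1 h1 x hx
    simp only [heval] at h
    simp only [generator, nablaPlus, centralDiff, smul_eq_mul, nsmul_eq_mul] at h ⊢
    linear_combination h
  · have h := hs.orthogonal 0 h0 1 h1 zero_ne_one
    have hk : (P 0).coeff 0 ≠ 0 := coeff_ne_zero_of_eq_degree hd0
    rw [eq_C_of_degree_le_zero hd0.le] at h
    simp only [heval, eval_C, integral_const_mul] at h
    simpa [hk, ha] using h

end Symmetry

/-! ### The stationary process -/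

section Stationary

variable {Ω : Type*} {mΩ : MeasurableSpace Ω} {ℱ : Filtration ℝ≥0 mΩ} {Pr : Measure Ω}
  {E : Set ℕ} {b d : ℕ → ℝ} {p : ℝ≥0 → ℕ → ℕ → ℝ} {N : ℝ≥0 → Ω → ℕ} {𝔪 : Measure ℕ}
  {lam : ℕ → ℝ} {P : ℕ → ℝ[X]}

theorem IsBirthDeathProcess.measurable (hN : IsBirthDeathProcess ℱ Pr E b d p N) (t : ℝ≥0) :
    Measurable (N t) :=
  (hN.adapted t).mono (ℱ.le t) le_rfl

theorem IsBirthDeathProcess.preimage_singleton_eq_empty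
    (hN : IsBirthDeathProcess ℱ Pr E b d p N) (t : ℝ≥0) {y : ℕ} (hy : y ∉ E) :
    N t ⁻¹' {y} = ∅ := by
  rw [Set.preimage_singleton_eq_empty]
  rintro ⟨ω, rfl⟩
  exact hy (hN.mem_state t ω)

theorem IsBirthDeathProcess.integral_comp (hN : IsBirthDeathProcess ℱ Pr E b d p N) {t : ℝ≥0}
    (hmap : Pr.map (N t) = 𝔪) (f : ℕ → ℝ) : ∫ ω, f (N t ω) ∂Pr = ∫ x, f x ∂𝔪 := by
  rw [← hmap]
  exact (integral_map (hN.measurable t).aemeasurable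
    measurable_from_nat.aestronglyMeasurable).symm

theorem IsBirthDeathProcess.memLp_comp (hN : IsBirthDeathProcess ℱ Pr E b d p N) {t : ℝ≥0}
    (hmap : Pr.map (N t) = 𝔪) {f : ℕ → ℝ} {q : ℝ≥0∞} (hf : MemLp f q 𝔪) :
    MemLp (fun ω => f (N t ω)) q Pr := by
  rw [← hmap] at hf
  exact (memLp_map_measure_iff measurable_from_nat.aestronglyMeasurable
    (hN.measurable t).aemeasurable).1 hf

/-- The Markov property, tested against a function of the present. -/
theorem IsBirthDeathProcess.setIntegral_comp (hN : IsBirthDeathProcess ℱ Pr E b d p N)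
    [IsProbabilityMeasure Pr] {s t : ℝ≥0} (hmap : Pr.map (N s) = 𝔪) {y : ℕ} (hy : y ∈ E)
    {f : ℕ → ℝ} (hf : Integrable f 𝔪) :
    ∫ ω in N (s + t) ⁻¹' {y}, f (N s ω) ∂Pr = ∫ x, f x * column E p y t x ∂𝔪 := by
  have hset : MeasurableSet (N (s + t) ⁻¹' {y}) :=
    hN.measurable _ (measurableSet_singleton y)
  have hfN : Integrable (fun ω => f (N s ω)) Pr :=
    memLp_one_iff_integrable.1 (hN.memLp_comp hmap (memLp_one_iff_integrable.2 hf))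
  have hind : (fun ω => f (N s ω)) * (N (s + t) ⁻¹' {y}).indicator (fun _ => (1 : ℝ)) =
      (N (s + t) ⁻¹' {y}).indicator fun ω => f (N s ω) := by
    ext ω
    by_cases h : ω ∈ N (s + t) ⁻¹' {y} <;> simp only [Pi.mul_apply, Set.indicator, h] <;> simp
  have hce := condExp_mul_of_stronglyMeasurable_left (m := ℱ s) (μ := Pr)
    (f := fun ω => f (N s ω)) (g := (N (s + t) ⁻¹' {y}).indicator fun _ => (1 : ℝ))
    (measurable_from_nat.comp (hN.adapted s)).stronglyMeasurable
    (hind ▸ hfN.indicator hset) ((integrable_const _).indicator hset)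
  rw [hind] at hce
  rw [← integral_indicator hset, ← integral_condExp (ℱ.le s),
    ← hN.integral_comp hmap fun x => f x * column E p y t x]
  refine integral_congr_ae ?_
  filter_upwards [hce, hN.markov s t y hy] with ω h1 h2
  rw [h1, Pi.mul_apply, h2, column_of_mem _ (hN.mem_state s ω), Real.toNNReal_coe]

/-- Stationarity: the Markov property at time `0`, tested against the constant `1`, and
invariance of `𝔪`. -/
theorem IsBirthDeathProcess.map_eq (hN : IsBirthDeathProcess ℱ Pr E b d p N)
    [IsProbabilityMeasure Pr] (hinv : IsInvariant E p 𝔪) (hinit : Pr.map (N 0) = 𝔪) (t : ℝ≥0) :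
    Pr.map (N t) = 𝔪 := by
  have := hinv.isProbability
  have hNt : IsProbabilityMeasure (Pr.map (N t)) :=
    Measure.isProbabilityMeasure_map (hN.measurable t).aemeasurable
  refine Measure.ext_of_singleton fun y => (measureReal_eq_measureReal_iff).1 ?_
  rw [map_measureReal_apply (hN.measurable t) (measurableSet_singleton y)]
  by_cases hy : y ∈ E
  · have h := hN.setIntegral_comp (t := t) hinit hy (integrable_const (1 : ℝ))
    simp only [integral_const, smul_eq_mul, mul_one, one_mul, zero_add,
      measureReal_restrict_apply_univ] at h
    rw [h]
    have hint : Integrable (column E p y t) 𝔪 :=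
      (integrable_const (1 : ℝ)).mono' measurable_from_nat.aestronglyMeasurable
        (.of_forall fun x => by
          rw [Real.norm_eq_abs, abs_of_nonneg (hN.transition.column_nonneg hy _ _)]
          exact hN.transition.column_le_one hy _ _)
    refine (hasSum_real_singleton_mul hint).unique ?_
    refine ((hasSum_subtype_iff_indicator
      (f := fun x : ℕ => 𝔪.real {x} * p t x y)).1 (hinv.invariant t y hy)).congr_fun fun x => ?_
    by_cases hx : x ∈ E <;> simp [column, hx]
  · rw [hinv.real_singleton_eq_zero hy]
    simp [hN.preimage_singleton_eq_empty t hy]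

/-- The autocorrelation of the linear eigenfunction, by conditioning on the later state. -/
theorem IsBirthDeathProcess.integral_mul_comp (hN : IsBirthDeathProcess ℱ Pr E b d p N)
    [IsProbabilityMeasure Pr] (hs : IsSolvable E b d p 𝔪 lam P) (hinit : Pr.map (N 0) = 𝔪)
    {c l : ℝ} (hc : ∀ x ∈ E, generator b d (fun x : ℕ => (x : ℝ) + c) x = l * (x + c))
    (s t : ℝ≥0) :
    ∫ ω, ((N s ω : ℝ) + c) * ((N (s + t) ω : ℝ) + c) ∂Pr =
      Real.exp (l * t) * ∫ x : ℕ, ((x : ℝ) + c) * (x + c) ∂𝔪 := by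
  have hinv := hs.invariant
  have := hinv.isProbability
  have hp := hN.transition
  have hv := hs.memLp_add_const hp.rates c
  have hmap := hN.map_eq hinv hinit
  have hU : ⋃ y : ℕ, N (s + t) ⁻¹' {y} = Set.univ := by
    ext ω
    simp
  have hint : Integrable (fun ω => ((N s ω : ℝ) + c) * ((N (s + t) ω : ℝ) + c)) Pr :=
    (hN.memLp_comp (hmap s) hv).integrable_mul (hN.memLp_comp (hmap (s + t)) hv)
  have h1 := hasSum_integral_iUnion (μ := Pr) (s := fun y : ℕ => N (s + t) ⁻¹' {y})
    (fun y => hN.measurable _ (measurableSet_singleton y))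
    (fun x y hxy => Disjoint.preimage _ (by simpa using hxy)) hint.integrableOn
  rw [hU, Measure.restrict_univ] at h1
  refine h1.unique ?_
  have h2 := (hasSum_real_singleton_mul (hv.integrable_mul hv)).mul_left (Real.exp (l * t))
  refine h2.congr_fun fun y => ?_
  have hset : MeasurableSet (N (s + t) ⁻¹' {y}) := hN.measurable _ (measurableSet_singleton y)
  have hconst : ∫ ω in N (s + t) ⁻¹' {y}, ((N s ω : ℝ) + c) * ((N (s + t) ω : ℝ) + c) ∂Pr =
      (∫ ω in N (s + t) ⁻¹' {y}, ((N s ω : ℝ) + c) ∂Pr) * (y + c) := by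
    rw [← integral_mul_const]
    refine setIntegral_congr_fun hset fun ω hω => ?_
    have : N (s + t) ω = y := hω
    simp only [this]
  rw [hconst, Pi.mul_apply]
  by_cases hy : y ∈ E
  · rw [hN.setIntegral_comp (hmap s) hy (hv.integrable one_le_two)]
    have hvc : Integrable (fun x : ℕ => ((x : ℝ) + c) * column E p y t x) 𝔪 :=
      (hv.integrable one_le_two).mul_bdd (c := 1) measurable_from_nat.aestronglyMeasurable
        (.of_forall fun x => by
          rw [Real.norm_eq_abs, abs_of_nonneg (hp.column_nonneg hy _ _)]
          exact hp.column_le_one hy _ _)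
    rw [(hasSum_real_singleton_mul hvc).unique (hs.hasSum_mul_column hp hc hy t.coe_nonneg)]
    ring
  · simp [hN.preimage_singleton_eq_empty _ hy, hinv.real_singleton_eq_zero hy]

theorem IsBirthDeathProcess.covariance_add (hN : IsBirthDeathProcess ℱ Pr E b d p N)
    [IsProbabilityMeasure Pr] (hs : IsSolvable E b d p 𝔪 lam P) (hinit : Pr.map (N 0) = 𝔪)
    {c l : ℝ} (hc : ∀ x ∈ E, generator b d (fun x : ℕ => (x : ℝ) + c) x = l * (x + c))
    (hmean : ∫ x : ℕ, ((x : ℝ) + c) ∂𝔪 = 0) (s t : ℝ≥0) :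
    cov[fun ω => (N s ω : ℝ), fun ω => (N (s + t) ω : ℝ); Pr] =
      Real.exp (l * t) * ∫ x : ℕ, ((x : ℝ) + c) * (x + c) ∂𝔪 := by
  have hp := hN.transition
  have hmap := hN.map_eq hs.invariant hinit
  have hid : MemLp (fun x : ℕ => (x : ℝ)) 2 𝔪 := by
    simpa using hs.memLp_add_const hp.rates 0
  have hv := hs.memLp_add_const hp.rates c
  rw [← covariance_add_const_left ((hN.memLp_comp (hmap s) hid).integrable one_le_two) c,
    ← covariance_add_const_right ((hN.memLp_comp (hmap (s + t)) hid).integrable one_le_two) c,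
    covariance_eq_sub (hN.memLp_comp (hmap s) hv) (hN.memLp_comp (hmap (s + t)) hv),
    hN.integral_comp (hmap s) fun x => (x : ℝ) + c, hmean, zero_mul, sub_zero]
  exact hN.integral_mul_comp hs hinit hc s t

end Stationary

end BirthDeath

theorem mainTheorem11 {Ω : Type*} {mΩ : MeasurableSpace Ω} (ℱ : Filtration ℝ≥0 mΩ)
    (Pr : Measure Ω) [IsProbabilityMeasure Pr]
    (E : Set ℕ) (b d : ℕ → ℝ) (p : ℝ≥0 → ℕ → ℕ → ℝ) (N : ℝ≥0 → Ω → ℕ)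
    (𝔪 : Measure ℕ) (lam : ℕ → ℝ) (P : ℕ → ℝ[X])
    (hN : BirthDeath.IsBirthDeathProcess ℱ Pr E b d p N)
    (hsolv : BirthDeath.IsSolvable E b d p 𝔪 lam P)
    (hinit : Pr.map (N 0) = 𝔪) :
    (∀ t, MemLp (fun ω => (N t ω : ℝ)) 2 Pr) ∧
    ∃ a₁ : ℝ, ∀ t s : ℝ≥0,
      cov[fun ω => (N t ω : ℝ), fun ω => (N s ω : ℝ); Pr] =
        a₁ ^ 2 * Real.exp (lam 1 * |(t : ℝ) - (s : ℝ)|) := by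
  have hr := hN.transition.rates
  have hmap := hN.map_eq hsolv.invariant hinit
  refine ⟨fun t => hN.memLp_comp (hmap t) (by simpa using hsolv.memLp_add_const hr 0), ?_⟩
  by_cases h1 : 1 ∈ E
  · obtain ⟨c, hc, hmean⟩ := hsolv.exists_linear_eigenfunction hr.zero_mem h1
    refine ⟨√(∫ x : ℕ, ((x : ℝ) + c) * (x + c) ∂𝔪), ?_⟩
    rw [Real.sq_sqrt (integral_nonneg fun x => mul_self_nonneg _)]
    have hle : ∀ s t : ℝ≥0, s ≤ t → cov[fun ω => (N s ω : ℝ), fun ω => (N t ω : ℝ); Pr] =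
        (∫ x : ℕ, ((x : ℝ) + c) * (x + c) ∂𝔪) * Real.exp (lam 1 * |(t : ℝ) - (s : ℝ)|) := by
      intro s t hst
      obtain ⟨r, rfl⟩ := exists_add_of_le hst
      rw [hN.covariance_add hsolv hinit hc hmean, mul_comm]
      simp
    intro t s
    rcases le_total s t with h | h
    · rw [covariance_comm, hle s t h]
    · rw [hle t s h, abs_sub_comm]
  · -- The state space is `{0}`, so the process is constant.
    have hzero : ∀ t ω, N t ω = 0 := fun t ω => by
      by_contra hne
      exact h1 (hr.segment.out hr.zero_mem (hN.mem_state t ω)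
        ⟨zero_le_one, Nat.one_le_iff_ne_zero.2 hne⟩)
    refine ⟨0, fun t s => ?_⟩
    simp only [hzero, Nat.cast_zero]
    rw [covariance_const_left]
    simp
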